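/- Let $n\geq 2$, let $\sigma$ be surface measure on the unit sphere $\mathbb{S}^{n-1}\subset\mathbb{R}^n$, and for $g\in L^1(\mathbb{S}^{n-1},\mathrm{d}\sigma)$, $g:\mathbb{S}^{n-1}\to\mathbb{C}$, write $$\widehat{g\,\mathrm{d}\sigma}(x)=\int_{\mathbb{S}^{n-1}}e^{-2\pi i x\cdot\omega}g(\omega)\,\mathrm{d}\sigma(\omega),\qquad x\in\mathbb{R}^n.$$ For $\omega\in\mathbb{S}^{n-1}$ let $\langle\omega\rangle^\perp$ be the orthogonal complement of the line spanned by $\omega$, let $Xw(\omega,v)=\int_{-\infty}^{\infty}w(v+t\omega)\,\mathrm{d}t$ $(v\in\langle\omega\rangle^\perp)$ be the X-ray transform of $w$, and let $R_\omega\omega'=2(\omega\cdot\omega')\omega-\omega'$ be the geodesic reflection of $\omega'\in\mathbb{S}^{n-1}$ in $\omega$. For $s\in\mathbb{R}$ and nonnegative functions $g_1,g_2$ on $\mathbb{S}^{n-1}$ let $$I_{\mathbb{S}^{n-1},s}(g_1,g_2)(\omega)=\int_{\mathbb{S}^{n-1}}\frac{g_1(\omega')\,g_2(R_\omega\omega')}{|\omega'-R_\omega\omega'|^{s}}\,|\omega\cdot\omega'|^{n-2}\,\mathrm{d}\sigma(\omega')\in[0,\infty],$$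 and for an integrable function $f$ on $\langle\omega\rangle^\perp$ let $$\|f\|_{\dot H^s(\langle\omega\rangle^\perp)}=\Big(\int_{\langle\omega\rangle^\perp}|\xi|^{2s}|\widehat f(\xi)|^2\,\mathrm{d}\xi\Big)^{1/2}\in[0,\infty],\qquad \widehat f(\xi)=\int_{\langle\omega\rangle^\perp}e^{-2\pi i v\cdot\xi}f(v)\,\mathrm{d}v.$$ Theorem (Spherical Sobolev–Stein inequality). There is a constant $c<\infty$ depending only on the dimension $n$ such that for every real $s<\frac{n-1}{2}$, every $g\in L^1(\mathbb{S}^{n-1},\mathrm{d}\sigma)$ and every nonnegative integrable weight $w$ on $\mathbb{R}^n$, $$\int_{\mathbb{R}^n}|\widehat{g\,\mathrm{d}\sigma}(x)|^2\,w(x)\,\mathrm{d}x\leq c\int_{\mathbb{S}^{n-1}}I_{\mathbb{S}^{n-1},2s}(|g|^2,|g|^2)(\omega)^{1/2}\,\|Xw(\omega,\cdot)\|_{\dot H^s(\langle\omega\rangle^\perp)}\,\mathrm{d}\sigma(\omega),$$ where $0\cdot\infty=0$ on the right-hand side. -/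

import Mathlib

open MeasureTheory Metric
open scoped ENNReal NNReal FourierTransform RealInnerProductSpace

noncomputable section

namespace SphericalSobolevStein

/-- Euclidean space `ℝⁿ`. -/
abbrev Space (n : ℕ) : Type := EuclideanSpace ℝ (Fin n)

/-- The unit sphere of `ℝⁿ`. -/
abbrev USphere (n : ℕ) : Type := sphere (0 : Space n) 1

/-- Surface measure on the unit sphere (the measure of polar coordinates, `dx = r ^ (n - 1) dr dσ`;
not normalized). -/
def surfaceMeasure (n : ℕ) : Measure (USphere n) := (volume : Measure (Space n)).toSphere

/-- The Fourier extension operator of the sphere,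
`x ↦ ∫ exp (- 2 π i x · ω) g(ω) dσ(ω)`. -/
def extension {n : ℕ} (g : USphere n → ℂ) (x : Space n) : ℂ :=
  ∫ ω, Complex.exp (-(2 * Real.pi * Complex.I * ((⟪x, (ω : Space n)⟫ : ℝ) : ℂ))) * g ω
    ∂(surfaceMeasure n)

/-- The orthogonal complement `⟨ω⟩^⊥` of the line spanned by `ω`. -/
abbrev perp {n : ℕ} (ω : USphere n) : Submodule ℝ (Space n) := (ℝ ∙ (ω : Space n))ᗮ

/-- The X-ray transform `Xw(ω, v) = ∫ w(v + t ω) dt`, for `v ∈ ⟨ω⟩^⊥`. -/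
def xray {n : ℕ} (w : Space n → ℝ) (ω : USphere n) (v : perp ω) : ℝ :=
  ∫ t : ℝ, w ((v : Space n) + t • (ω : Space n))

theorem geodesicReflection_mem {n : ℕ} (ω ω' : USphere n) :
    (2 * ⟪(ω : Space n), (ω' : Space n)⟫) • (ω : Space n) - (ω' : Space n)
      ∈ sphere (0 : Space n) 1 := by
  have h1 : ‖(ω : Space n)‖ = 1 := by simp
  have h2 : ‖(ω' : Space n)‖ = 1 := by simp
  rw [mem_sphere_zero_iff_norm]
  have h : ‖(2 * ⟪(ω : Space n), (ω' : Space n)⟫) • (ω : Space n) - (ω' : Space n)‖ ^ 2 = 1 := by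
    rw [norm_sub_sq_real, norm_smul, mul_pow, real_inner_smul_left, h1, h2, Real.norm_eq_abs,
      sq_abs]
    ring
  exact (sq_eq_sq₀ (norm_nonneg _) zero_le_one).1 (by rw [h, one_pow])

/-- The geodesic reflection `R_ω ω' = 2 (ω · ω') ω - ω'` of `ω'` in `ω`. -/
def geodesicReflection {n : ℕ} (ω ω' : USphere n) : USphere n :=
  ⟨(2 * ⟪(ω : Space n), (ω' : Space n)⟫) • (ω : Space n) - (ω' : Space n),
    geodesicReflection_mem ω ω'⟩

/-- The bilinear fractional integral of order `s` on the sphere, for nonnegative functions: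
`∫ g₁(ω') g₂(R_ω ω') |ω' - R_ω ω'| ^ (-s) |ω · ω'| ^ (n - 2) dσ(ω')`, with values in `[0, ∞]`. -/
def fractionalIntegral {n : ℕ} (s : ℝ) (g₁ g₂ : USphere n → ℝ≥0∞) (ω : USphere n) : ℝ≥0∞ :=
  ∫⁻ ω', g₁ ω' * g₂ (geodesicReflection ω ω')
      / ‖(ω' : Space n) - (geodesicReflection ω ω' : Space n)‖ₑ ^ s
      * ‖(⟪(ω : Space n), (ω' : Space n)⟫ : ℝ)‖ₑ ^ (n - 2) ∂(surfaceMeasure n)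

/-- The homogeneous `L²` Sobolev norm of order `s` of an integrable function `f` on a
finite-dimensional Euclidean space `V`, with values in `[0, ∞]`:
`(∫ |ξ| ^ (2 s) |f̂(ξ)|² dξ) ^ (1 / 2)`, where `f̂(ξ) = ∫ exp (- 2 π i v · ξ) f(v) dv`.
Here `dv`, `dξ` are Lebesgue measure for the inner product of `V`. -/
def homSobolevNorm {V : Type*} [NormedAddCommGroup V] [InnerProductSpace ℝ V]
    [FiniteDimensional ℝ V] [MeasurableSpace V] [BorelSpace V] (s : ℝ) (f : V → ℝ) : ℝ≥0∞ :=
  (∫⁻ ξ : V, ‖ξ‖ₑ ^ (2 * s) * ‖𝓕 (fun v : V => (f v : ℂ)) ξ‖ₑ ^ 2) ^ (1 / 2 : ℝ)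

end SphericalSobolevStein

end

/-! Expanding the square and integrating in x first bounds the left-hand side by the double integral
of |g(a)||g(b)||ŵ(a - b)| (`lintegral_extension_sq_le`). Substitute b = R_ω a with a fixed. Since ω
↦ R_ω a is a Lipschitz surjection, this costs only a dimensional constant, with no Jacobian computed
(`surfaceMeasure_le_map`). After swapping integrals, ω is fixed and the chord a - R_ω a lies in
⟨ω⟩^⊥, where ŵ is the Fourier transform of Xw(ω, ·) (`fourier_xray`). Cauchy–Schwarz with the
factors |chord|^(-s) and |chord|^s then separates the fractional integral from the Sobolev norm
(`lintegral_fibre_le`).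

The second factor requires the image of σ under the chord map to be dominated by Lebesgue measure
(`map_chord_le`), and the first requires a lower bound for |ω · a|^(n - 2). Both are available once
|ω · a| is bounded below. Splitting g into its 2^n orthant pieces arranges this: if a and R_ω a
share an orthant, then 0 ≤ a · R_ω a = 2 (ω · a)² - 1. -/

noncomputable section

namespace SphericalSobolevStein

open Module Measure
open scoped Pointwise ComplexConjugate

/-! ### Volume and surface measure under Lipschitz maps -/

/-- A relation along which distances expand by a factor at least `K⁻¹` bounds volumes. -/
theorem volume_le_of_antilipschitz_relation {n : ℕ} {A T : Set (Space n)} {K : ℝ≥0}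
    (r : Space n → Space n → Prop) (hAT : ∀ x ∈ A, ∃ y ∈ T, r x y)
    (hr : ∀ x x' y y', r x y → r x' y' → dist x x' ≤ K * dist y y') :
    volume A ≤ (K : ℝ≥0∞) ^ n * volume T := by
  choose! φ hφT hφ using hAT
  have hanti : AntilipschitzWith K (A.domRestrict φ) :=
    AntilipschitzWith.of_le_mul_dist fun x y => hr _ _ _ _ (hφ x x.2) (hφ y y.2)
  have h1 := hanti.le_hausdorffMeasure_image (d := n) (by positivity) Set.univ
  have h2 : A.domRestrict φ '' Set.univ ⊆ T := by
    rintro _ ⟨x, -, rfl⟩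
    exact hφT x x.2
  have h3 : μH[n] (Set.univ : Set A) = μH[n] A := by
    rw [← isometry_subtype_coe.hausdorffMeasure_image (Or.inl (by positivity))]
    simp
  have h4 : μH[n] A ≤ (K : ℝ≥0∞) ^ n * μH[n] T := by
    rw [← h3]
    refine h1.trans ?_
    rw [ENNReal.rpow_natCast]
    gcongr
  -- Volume is a fixed multiple of n-dimensional Hausdorff measure, so the normalizing factor
  -- cancels.
  rw [← EuclideanSpace.euclideanHausdorffMeasure_eq_volume n, euclideanHausdorffMeasure_def,
    Measure.smul_apply, Measure.smul_apply, mul_smul_comm]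
  gcongr

/-- Turns comparisons of surface measures into comparisons of volumes of cones. -/
theorem surfaceMeasure_apply {n : ℕ} {s : Set (USphere n)} (hs : MeasurableSet s) :
    surfaceMeasure n s = n * volume (Set.Ioo (0 : ℝ) 1 • ((↑) '' s : Set (Space n))) := by
  rw [surfaceMeasure, toSphere_apply' _ hs]
  simp

instance {n : ℕ} : IsFiniteMeasure (surfaceMeasure n) := by
  unfold surfaceMeasure; infer_instance

theorem dist_smul_unit_le {n : ℕ} {ρ ρ' : ℝ} (hρ' : 0 ≤ ρ') (a a' : Space n) (ha : ‖a‖ = 1) :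
    dist (ρ • a) (ρ' • a') ≤ |ρ - ρ'| + ρ' * dist a a' := by
  have : ρ • a - ρ' • a' = (ρ - ρ') • a + ρ' • (a - a') := by module
  rw [dist_eq_norm, dist_eq_norm, this]
  refine (norm_add_le _ _).trans ?_
  rw [norm_smul, norm_smul, ha, Real.norm_eq_abs, Real.norm_eq_abs, abs_of_nonneg hρ', mul_one]

theorem abs_sub_le_dist_smul_unit {n : ℕ} {ρ ρ' : ℝ} (hρ : 0 ≤ ρ) (hρ' : 0 ≤ ρ') (a a' : Space n)
    (ha : ‖a‖ = 1) (ha' : ‖a'‖ = 1) : |ρ - ρ'| ≤ dist (ρ • a) (ρ' • a') := by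
  have := abs_norm_sub_norm_le (ρ • a) (ρ' • a')
  rw [norm_smul, norm_smul, ha, ha', Real.norm_eq_abs, Real.norm_eq_abs, abs_of_nonneg hρ',
    abs_of_nonneg hρ, mul_one, mul_one] at this
  rwa [dist_eq_norm]

/-- The angular displacement is the full displacement minus the radial one, and each of these is at
most the distance; hence the factor 2. -/
theorem mul_dist_unit_le {n : ℕ} {ρ ρ' : ℝ} (hρ : 0 ≤ ρ) (hρ' : 0 ≤ ρ') (a a' : Space n)
    (ha : ‖a‖ = 1) (ha' : ‖a'‖ = 1) : ρ' * dist a a' ≤ 2 * dist (ρ • a) (ρ' • a') := by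
  have h1 := abs_sub_le_dist_smul_unit hρ hρ' a a' ha ha'
  have h2 : ρ' • (a - a') = (ρ • a - ρ' • a') - (ρ - ρ') • a := by module
  have h3 := norm_sub_le (ρ • a - ρ' • a') ((ρ - ρ') • a)
  rw [← h2, norm_smul, norm_smul, ha, Real.norm_eq_abs, Real.norm_eq_abs, abs_of_nonneg hρ',
    mul_one, ← dist_eq_norm, ← dist_eq_norm] at h3
  linarith

/-- Surface measure is dominated by its pushforward under a Lipschitz surjection. -/
theorem surfaceMeasure_le_map {n : ℕ} {K : ℝ≥0} {Ψ : USphere n → USphere n}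
    (hΨ : LipschitzWith K Ψ) (hs : Function.Surjective Ψ) :
    surfaceMeasure n ≤ ((1 + 2 * K : ℝ≥0) ^ n : ℝ≥0) • (surfaceMeasure n).map Ψ := by
  refine Measure.le_iff.2 fun s hsm => ?_
  have hm : Measurable Ψ := hΨ.continuous.measurable
  rw [Measure.smul_apply, Measure.map_apply hm hsm, surfaceMeasure_apply hsm,
    surfaceMeasure_apply (hm hsm), ENNReal.smul_def, smul_eq_mul, mul_left_comm, ENNReal.coe_pow]
  gcongr
  -- Pairs ρ Ψ(b) with ρ b. In the constant 1 + 2K, the radial part contributes 1 and the angular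
  -- part 2K.
  refine volume_le_of_antilipschitz_relation
    (fun x y => ∃ ρ : ℝ, 0 ≤ ρ ∧ ∃ b : USphere n, x = ρ • (Ψ b : Space n) ∧ y = ρ • (b : Space n))
    ?_ ?_
  · rintro _ ⟨ρ, hρ, _, ⟨a, ha, rfl⟩, rfl⟩
    obtain ⟨b, rfl⟩ := hs a
    exact ⟨ρ • (b : Space n), ⟨ρ, hρ, _, ⟨b, ha, rfl⟩, rfl⟩, ρ, hρ.1.le, b, rfl, rfl⟩
  · rintro _ _ _ _ ⟨ρ, hρ, b, rfl, rfl⟩ ⟨ρ', hρ', b', rfl, rfl⟩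
    have hb : ∀ c : USphere n, ‖(c : Space n)‖ = 1 := fun c => by simp
    have h1 := dist_smul_unit_le (ρ := ρ) hρ' (Ψ b : Space n) (Ψ b') (hb _)
    have h2 : dist (Ψ b : Space n) (Ψ b') ≤ K * dist (b : Space n) b' := hΨ.dist_le_mul b b'
    have h3 := abs_sub_le_dist_smul_unit hρ hρ' (b : Space n) b' (hb _) (hb _)
    have h4 := mul_dist_unit_le hρ hρ' (b : Space n) b' (hb _) (hb _)
    have h5 := mul_le_mul_of_nonneg_left h2 hρ'
    have h6 := mul_le_mul_of_nonneg_left h4 K.coe_nonneg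
    push_cast
    nlinarith

/-! ### Geodesic reflections -/

theorem norm_usphere {n : ℕ} (a : USphere n) : ‖(a : Space n)‖ = 1 := by simp

theorem coe_geodesicReflection {n : ℕ} (ω a : USphere n) : (geodesicReflection ω a : Space n) =
    (2 * ⟪(ω : Space n), (a : Space n)⟫) • (ω : Space n) - (a : Space n) := rfl

theorem continuous_geodesicReflection {n : ℕ} :
    Continuous fun p : USphere n × USphere n => geodesicReflection p.1 p.2 := by
  unfold geodesicReflection
  fun_prop

theorem inner_self_usphere {n : ℕ} (a : USphere n) : ⟪(a : Space n), (a : Space n)⟫ = 1 := by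
  simp

theorem inner_geodesicReflection {n : ℕ} (ω a : USphere n) :
    ⟪(ω : Space n), (geodesicReflection ω a : Space n)⟫ = ⟪(ω : Space n), (a : Space n)⟫ := by
  rw [coe_geodesicReflection, inner_sub_right, real_inner_smul_right, inner_self_usphere]
  ring

theorem geodesicReflection_involutive {n : ℕ} (ω : USphere n) :
    Function.Involutive (geodesicReflection ω) := by
  intro a
  apply Subtype.ext
  rw [coe_geodesicReflection, inner_geodesicReflection, coe_geodesicReflection]
  abel

/-- The map is in fact an isometry; the crude constant 2 + 1 suffices for continuity and for
preserving null sets. -/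
theorem lipschitzWith_geodesicReflection_right {n : ℕ} (ω : USphere n) :
    LipschitzWith 3 (geodesicReflection ω) := by
  refine LipschitzWith.of_dist_le_mul fun a b => ?_
  change dist (geodesicReflection ω a : Space n) (geodesicReflection ω b) ≤
    _ * dist (a : Space n) b
  rw [dist_eq_norm, dist_eq_norm]
  have h : (geodesicReflection ω a : Space n) - geodesicReflection ω b =
      (2 * ⟪(ω : Space n), (a : Space n) - b⟫) • (ω : Space n) - ((a : Space n) - b) := by
    rw [coe_geodesicReflection, coe_geodesicReflection, inner_sub_right]
    module
  have h1 := abs_real_inner_le_norm (ω : Space n) ((a : Space n) - b)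
  rw [norm_usphere, one_mul] at h1
  rw [h]
  refine (norm_sub_le _ _).trans ?_
  rw [norm_smul, norm_usphere, Real.norm_eq_abs, abs_mul, abs_two]
  norm_num
  linarith

/-- The map is quadratic in ω; changing one occurrence of ω at a time costs 2 each. -/
theorem lipschitzWith_geodesicReflection_left {n : ℕ} (a : USphere n) :
    LipschitzWith 4 fun ω => geodesicReflection ω a := by
  refine LipschitzWith.of_dist_le_mul fun ω η => ?_
  change dist (geodesicReflection ω a : Space n) (geodesicReflection η a) ≤
    _ * dist (ω : Space n) η
  rw [dist_eq_norm, dist_eq_norm]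
  have h : (geodesicReflection ω a : Space n) - geodesicReflection η a =
      (2 * ⟪(ω : Space n) - η, (a : Space n)⟫) • (ω : Space n)
        + (2 * ⟪(η : Space n), (a : Space n)⟫) • ((ω : Space n) - η) := by
    rw [coe_geodesicReflection, coe_geodesicReflection, inner_sub_left]
    module
  have h1 := abs_real_inner_le_norm ((ω : Space n) - η) a
  have h2 := abs_real_inner_le_norm (η : Space n) a
  rw [norm_usphere, mul_one] at h1
  rw [norm_usphere, norm_usphere, one_mul] at h2
  rw [h]
  refine (norm_add_le _ _).trans ?_
  rw [norm_smul, norm_smul, norm_usphere, Real.norm_eq_abs, Real.norm_eq_abs, abs_mul, abs_mul,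
    abs_two]
  have := mul_le_mul_of_nonneg_right h2 (norm_nonneg ((ω : Space n) - η))
  norm_num
  linarith

theorem finrank_perp {n : ℕ} (ω : USphere n) : finrank ℝ (perp ω) + 1 = n := by
  have h : finrank ℝ (ℝ ∙ (ω : Space n)) + finrank ℝ (perp ω) = finrank ℝ (Space n) :=
    (ℝ ∙ (ω : Space n)).finrank_add_finrank_orthogonal
  have hne : (ω : Space n) ≠ 0 := by
    intro h0; have := norm_usphere ω; rw [h0, norm_zero] at this; norm_num at this
  rw [finrank_span_singleton hne, finrank_euclideanSpace_fin] at h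
  omega

theorem nontrivial_perp {n : ℕ} (hn : 2 ≤ n) (ω : USphere n) : Nontrivial (perp ω) :=
  Module.finrank_pos_iff (R := ℝ).1 (by have := finrank_perp ω; omega)

theorem mem_perp_iff {n : ℕ} (ω : USphere n) (x : Space n) : x ∈ perp ω ↔ ⟪(ω : Space n), x⟫ = 0 :=
  Submodule.mem_orthogonal_singleton_iff_inner_right

/-- The point carrying a to b is the normalized midpoint of a and b. If b = -a, any unit vector
orthogonal to a works, and one exists because n ≥ 2. -/
theorem surjective_geodesicReflection_left {n : ℕ} (hn : 2 ≤ n) (a : USphere n) :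
    Function.Surjective fun ω => geodesicReflection ω a := by
  intro b
  by_cases hab : (a : Space n) + b = 0
  · obtain ⟨v, hv⟩ := @exists_ne _ (nontrivial_perp hn a) (0 : perp a)
    have hv' : ‖(v : Space n)‖ ≠ 0 := by simpa using hv
    refine ⟨⟨(‖(v : Space n)‖)⁻¹ • (v : Space n), ?_⟩, ?_⟩
    · rw [mem_sphere_zero_iff_norm, norm_smul, norm_inv, norm_norm, inv_mul_cancel₀ hv']
    · apply Subtype.ext
      have := (mem_perp_iff a v).1 v.2
      rw [coe_geodesicReflection, real_inner_smul_left, real_inner_comm, this]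
      simp only [mul_zero, zero_smul, zero_sub]
      exact neg_eq_of_add_eq_zero_right hab
  · have h0 : ‖(a : Space n) + b‖ ≠ 0 := by simpa using hab
    refine ⟨⟨(‖(a : Space n) + b‖)⁻¹ • ((a : Space n) + b), ?_⟩, ?_⟩
    · rw [mem_sphere_zero_iff_norm, norm_smul, norm_inv, norm_norm, inv_mul_cancel₀ h0]
    · apply Subtype.ext
      have h2 : ‖(a : Space n) + b‖ ^ 2 = 2 * ⟪(a : Space n) + b, (a : Space n)⟫ := by
        rw [norm_add_sq_real, inner_add_left, inner_self_usphere, norm_usphere, norm_usphere,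
          real_inner_comm]
        ring
      rw [coe_geodesicReflection, real_inner_smul_left, smul_smul]
      have h3 : 2 * (‖(a : Space n) + b‖⁻¹ * ⟪(a : Space n) + b, (a : Space n)⟫)
          * ‖(a : Space n) + b‖⁻¹ = 1 := by
        field_simp
        exact h2.symm
      rw [h3]
      simp

/-! ### The splitting ⟨ω⟩^⊥ × ℝ and the chord map -/

/-- Euclidean space splits as the orthogonal product of a hyperplane and a line. -/
def perpProdEquiv {n : ℕ} (ω : USphere n) : perp ω × ℝ ≃ᵐ Space n :=
  (MeasurableEquiv.prodComm.trans
    ((LinearIsometryEquiv.toSpanUnitSingleton (ω : Space n)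
      (norm_usphere ω)).toHomeomorph.toMeasurableEquiv.prodCongr (MeasurableEquiv.refl _))).trans
  ((MeasurableEquiv.toLp 2 _).trans
    (ℝ ∙ (ω : Space n)).orthogonalDecomposition.symm.toHomeomorph.toMeasurableEquiv)

theorem perpProdEquiv_apply {n : ℕ} (ω : USphere n) (p : perp ω × ℝ) :
    perpProdEquiv ω p = (p.1 : Space n) + p.2 • (ω : Space n) := by
  change (ℝ ∙ (ω : Space n)).orthogonalDecomposition.symm
    (WithLp.toLp 2 (LinearIsometryEquiv.toSpanUnitSingleton (ω : Space n)
      (norm_usphere ω) p.2, p.1)) = _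
  rw [Submodule.orthogonalDecomposition_symm_apply, add_comm]
  rfl

theorem measurePreserving_perpProdEquiv {n : ℕ} (ω : USphere n) :
    MeasurePreserving (perpProdEquiv ω) (volume.prod volume) volume := by
  have h1 : MeasurePreserving (Prod.swap : perp ω × ℝ → ℝ × perp ω)
    (volume.prod volume) (volume.prod volume) := Measure.measurePreserving_swap
  have h2 : MeasurePreserving (LinearIsometryEquiv.toSpanUnitSingleton (ω : Space n)
      (norm_usphere ω)) volume volume := LinearIsometryEquiv.measurePreserving _
  have h3 := h2.prod (MeasurePreserving.id (volume : Measure (perp ω)))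
  have h4 : MeasurePreserving (WithLp.toLp 2 : (ℝ ∙ (ω : Space n)) × perp ω → _)
    (volume.prod volume) volume := WithLp.volume_preserving_toLp _ _
  have h5 : MeasurePreserving (ℝ ∙ (ω : Space n)).orthogonalDecomposition.symm volume volume :=
    LinearIsometryEquiv.measurePreserving _
  exact h5.comp (h4.comp (h3.comp h1))

/-- The chord `a - R_ω a`, as a vector of `⟨ω⟩^⊥`. -/
def chord {n : ℕ} (ω a : USphere n) : perp ω :=
  ⟨(a : Space n) - geodesicReflection ω a, by
    rw [mem_perp_iff, inner_sub_right, inner_geodesicReflection, sub_self]⟩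

theorem coe_chord {n : ℕ} (ω a : USphere n) :
    (chord ω a : Space n) = (a : Space n) - geodesicReflection ω a := rfl

theorem continuous_chord {n : ℕ} (ω : USphere n) : Continuous (chord ω) := by
  unfold chord
  have : Continuous fun a => geodesicReflection ω a :=
    (lipschitzWith_geodesicReflection_right ω).continuous
  fun_prop

/-- The chord is twice the projection of a to ⟨ω⟩^⊥, so Pythagoras applies. Its length therefore
determines |ω · a|. -/
theorem norm_chord_sq {n : ℕ} (ω a : USphere n) :
    ‖chord ω a‖ ^ 2 = 4 * (1 - ⟪(ω : Space n), (a : Space n)⟫ ^ 2) := by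
  have h : ‖(chord ω a : Space n)‖ ^ 2 = 4 * (1 - ⟪(ω : Space n), (a : Space n)⟫ ^ 2) := by
    have : (chord ω a : Space n) = (2 : ℝ) • (a - ⟪(ω : Space n), (a : Space n)⟫ • (ω : Space n)) := by
      rw [coe_chord, coe_geodesicReflection]; module
    rw [this, norm_smul, mul_pow, norm_sub_sq_real, norm_smul, real_inner_smul_right,
      norm_usphere, norm_usphere, real_inner_comm, Real.norm_eq_abs, Real.norm_eq_abs, mul_pow,
      sq_abs]
    norm_num
    ring
  exact h

/-- Half the chord is the component of a orthogonal to ω. The heights α, β along ω are recovered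
from 4(α² - β²) = ‖q‖² - ‖p‖² on dividing by |α + β| ≥ 2c. The heights contribute c⁻¹ to the
constant, and the orthogonal parts 1/2, rounded up to 1. -/
theorem dist_le_mul_dist_chord {n : ℕ} {c ε : ℝ} (hc : 0 < c) (hε : |ε| = 1) (ω a b : USphere n)
    (ha : c ≤ ε * ⟪(ω : Space n), (a : Space n)⟫) (hb : c ≤ ε * ⟪(ω : Space n), (b : Space n)⟫) :
    dist (a : Space n) b ≤ (c⁻¹ + 1) * dist (chord ω a) (chord ω b) := by
  set α := ⟪(ω : Space n), (a : Space n)⟫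
  set β := ⟪(ω : Space n), (b : Space n)⟫
  have hp := norm_chord_sq ω a
  have hq := norm_chord_sq ω b
  set p := chord ω a
  set q := chord ω b
  have hp2 : ‖p‖ ≤ 2 := by nlinarith [norm_nonneg p, sq_nonneg α]
  have hq2 : ‖q‖ ≤ 2 := by nlinarith [norm_nonneg q, sq_nonneg β]
  have hε2 : ε ^ 2 = 1 := by rw [← sq_abs, hε, one_pow]
  have h1 : c * |α - β| ≤ dist p q := by
    have h2 : |α - β| * (ε * α + ε * β) ≤ 2 * dist p q := by
      have h3 : (α - β) * (ε * α + ε * β) = ε * ((‖q‖ - ‖p‖) * (‖q‖ + ‖p‖) / 4) := by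
        linear_combination ε / 4 * hp - ε / 4 * hq
      have h4 : |α - β| * (ε * α + ε * β) = |‖q‖ - ‖p‖| * (‖q‖ + ‖p‖) / 4 := by
        have := congrArg abs h3
        rw [abs_mul, abs_of_nonneg (a := ε * α + ε * β) (by linarith), abs_mul, hε, one_mul,
          abs_div, abs_mul, abs_of_nonneg (a := ‖q‖ + ‖p‖) (by positivity)] at this
        rw [this]; norm_num
      rw [h4, dist_comm, dist_eq_norm]
      have := abs_norm_sub_norm_le q p
      nlinarith [norm_nonneg q, norm_nonneg p, abs_nonneg (‖q‖ - ‖p‖)]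
    nlinarith [abs_nonneg (α - β)]
  have h2 : (a : Space n) - b = (α - β) • (ω : Space n) + (1 / 2 : ℝ) • ((p : Space n) - q) := by
    rw [coe_chord, coe_chord, coe_geodesicReflection, coe_geodesicReflection]
    module
  rw [dist_eq_norm, h2]
  refine (norm_add_le _ _).trans ?_
  rw [norm_smul, norm_smul, norm_usphere, mul_one, Real.norm_eq_abs]
  have h3 : ‖(p : Space n) - q‖ = dist p q := by
    rw [dist_eq_norm]; rfl
  have h4 : |α - β| ≤ c⁻¹ * dist p q := by
    rw [inv_mul_eq_div, le_div_iff₀ hc]; linarith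
  rw [h3]
  norm_num
  nlinarith [dist_nonneg (x := p) (y := q)]

theorem norm_le_norm_perp_add {n : ℕ} (ω : USphere n) (v : perp ω) (t : ℝ) :
    ‖v‖ ≤ ‖(v : Space n) + t • (ω : Space n)‖ ∧ |t| ≤ ‖(v : Space n) + t • (ω : Space n)‖ := by
  have h : ‖(v : Space n) + t • (ω : Space n)‖ ^ 2 = ‖v‖ ^ 2 + t ^ 2 := by
    rw [norm_add_sq_real, real_inner_smul_right, real_inner_comm, (mem_perp_iff ω v).1 v.2,
      norm_smul, norm_usphere, mul_one, Real.norm_eq_abs, sq_abs]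
    simp
  constructor
  · exact le_of_sq_le_sq (by nlinarith) (norm_nonneg _)
  · exact abs_le_of_sq_le_sq (by nlinarith [sq_nonneg ‖v‖]) (norm_nonneg _)

/-- The point ρ a of the cone is paired with the point (chord, ρ) of the cylinder E × (0, 1), whose
volume is that of E. In c⁻¹ + 2, the radius contributes 1 and `dist_le_mul_dist_chord` the rest. -/
theorem surfaceMeasure_chord_preimage_le {n : ℕ} {c ε : ℝ} (hc : 0 < c) (hε : |ε| = 1)
    (ω : USphere n) {E : Set (perp ω)} (hE : MeasurableSet E) :
    surfaceMeasure n ({a | c ≤ ε * ⟪(ω : Space n), (a : Space n)⟫} ∩ chord ω ⁻¹' E) ≤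
      n * ((Real.toNNReal (c⁻¹ + 2) : ℝ≥0∞) ^ n * volume E) := by
  have hcl : MeasurableSet {a : USphere n | c ≤ ε * ⟪(ω : Space n), (a : Space n)⟫} :=
    (isClosed_le (by fun_prop) (by fun_prop)).measurableSet
  rw [surfaceMeasure_apply (hcl.inter ((continuous_chord ω).measurable hE))]
  gcongr
  have hT : volume (perpProdEquiv ω '' (E ×ˢ Set.Ioo 0 1)) = volume E := by
    rw [MeasurableEquiv.image_eq_preimage_symm,
      (measurePreserving_perpProdEquiv ω).symm.measure_preimage
        (hE.prod measurableSet_Ioo).nullMeasurableSet, Measure.prod_prod]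
    simp
  rw [← hT]
  refine volume_le_of_antilipschitz_relation
    (fun x y => ∃ ρ : ℝ, 0 < ρ ∧ ρ < 1 ∧ ∃ a : USphere n,
      c ≤ ε * ⟪(ω : Space n), (a : Space n)⟫ ∧ x = ρ • (a : Space n) ∧
        y = (chord ω a : Space n) + ρ • (ω : Space n)) ?_ ?_
  · rintro _ ⟨ρ, hρ, _, ⟨a, ha, rfl⟩, rfl⟩
    exact ⟨_, ⟨(chord ω a, ρ), ⟨ha.2, hρ⟩, rfl⟩, ρ, hρ.1, hρ.2, a, ha.1, rfl,
      perpProdEquiv_apply _ _⟩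
  · rintro _ _ _ _ ⟨ρ, hρ, hρ1, a, ha, rfl, rfl⟩ ⟨ρ', hρ', hρ1', a', ha', rfl, rfl⟩
    have h1 := dist_smul_unit_le (ρ := ρ) hρ'.le (a : Space n) a' (norm_usphere a)
    have h2 := dist_le_mul_dist_chord hc hε ω a a' ha ha'
    have h3 := norm_le_norm_perp_add ω (chord ω a - chord ω a') (ρ - ρ')
    have h4 : ((chord ω a - chord ω a' : perp ω) : Space n) + (ρ - ρ') • (ω : Space n) =
      ((chord ω a : Space n) + ρ • (ω : Space n)) -
        ((chord ω a' : Space n) + ρ' • (ω : Space n)) := by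
      push_cast; module
    rw [h4, ← dist_eq_norm, ← dist_eq_norm] at h3
    have hc' : 0 < c⁻¹ := inv_pos.2 hc
    rw [Real.coe_toNNReal _ (by positivity)]
    have h5 : ρ' * dist (a : Space n) a' ≤ dist (a : Space n) a' :=
      mul_le_of_le_one_left dist_nonneg hρ1'.le
    have h6 := mul_le_mul_of_nonneg_left h3.1 (by positivity : 0 ≤ c⁻¹ + 1)
    linarith [h3.2]

/-- Away from the equator orthogonal to `ω`, the chord map pushes surface measure to a measure
dominated by Lebesgue measure. -/
theorem map_chord_le {n : ℕ} {c : ℝ} (hc : 0 < c) (ω : USphere n) :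
    ((surfaceMeasure n).restrict {a | c ≤ |⟪(ω : Space n), (a : Space n)⟫|}).map (chord ω) ≤
      (2 * n * Real.toNNReal (c⁻¹ + 2) ^ n : ℝ≥0) • volume := by
  refine Measure.le_iff.2 fun E hE => ?_
  have hcl : MeasurableSet {a : USphere n | c ≤ |⟪(ω : Space n), (a : Space n)⟫|} :=
    (isClosed_le (by fun_prop) (by fun_prop)).measurableSet
  have hm := (continuous_chord ω).measurable
  rw [Measure.map_apply hm hE, Measure.restrict_apply (hm hE), Measure.smul_apply,
    ENNReal.smul_def, smul_eq_mul]
  -- The two signs of ω · a give two caps, whence the factor 2.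
  have hsub : chord ω ⁻¹' E ∩ {a : USphere n | c ≤ |⟪(ω : Space n), (a : Space n)⟫|} ⊆
      ({a | c ≤ 1 * ⟪(ω : Space n), (a : Space n)⟫} ∩ chord ω ⁻¹' E) ∪
      ({a | c ≤ -1 * ⟪(ω : Space n), (a : Space n)⟫} ∩ chord ω ⁻¹' E) := by
    rintro a ⟨h1, h2⟩
    rcases le_abs.1 (Set.mem_ofPred.1 h2) with h | h
    · exact Or.inl ⟨by simpa using h, h1⟩
    · exact Or.inr ⟨by simpa using h, h1⟩
  refine (measure_mono hsub).trans ((measure_union_le _ _).trans ?_)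
  refine (add_le_add (surfaceMeasure_chord_preimage_le hc (by simp) ω hE)
    (surfaceMeasure_chord_preimage_le hc (by simp) ω hE)).trans (le_of_eq ?_)
  push_cast
  ring

/-! ### Fourier slicing and expansion of the square -/

/-- Fourier slicing: the Fourier transform of the X-ray transform is the restriction of the
Fourier transform to the hyperplane. -/
theorem fourier_xray {n : ℕ} {w : Space n → ℝ} (hw : Integrable w) (ω : USphere n) (ξ : perp ω) :
    𝓕 (fun v : perp ω => (xray w ω v : ℂ)) ξ = 𝓕 (fun x : Space n => (w x : ℂ)) (ξ : Space n) := by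
  have hmp := measurePreserving_perpProdEquiv ω
  have hcont : Continuous fun x : Space n => Real.fourierChar (-⟪x, (ξ : Space n)⟫) := by
    fun_prop
  have hint : Integrable fun x : Space n =>
      Real.fourierChar (-⟪x, (ξ : Space n)⟫) • (w x : ℂ) := by
    have h : Integrable fun x => (w x : ℂ) := hw.ofReal
    rw [← integrable_norm_iff (hcont.aestronglyMeasurable.fun_smul h.1)]
    simp_rw [Circle.norm_smul]
    exact h.norm
  rw [Real.fourier_eq, Real.fourier_eq, ← hmp.integral_comp (perpProdEquiv ω).measurableEmbedding,
    integral_prod]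
  · refine integral_congr_ae (Filter.Eventually.of_forall fun v => ?_)
    simp only [perpProdEquiv_apply, xray]
    -- The character is constant in t because ξ ⊥ ω, so the inner integral is the X-ray transform.
    have h : ∀ t : ℝ, ⟪(v : Space n) + t • (ω : Space n), (ξ : Space n)⟫ = ⟪v, ξ⟫ := fun t => by
      rw [inner_add_left, real_inner_smul_left, (mem_perp_iff ω ξ).1 ξ.2, mul_zero, add_zero]
      rfl
    simp_rw [h]
    simp_rw [Circle.smul_def, smul_eq_mul]
    rw [integral_const_mul, integral_complex_ofReal]
  · exact (hmp.integrable_comp_emb (perpProdEquiv ω).measurableEmbedding).2 hint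

theorem norm_exp_neg_two_pi_I_mul (t : ℝ) :
    ‖Complex.exp (-(2 * Real.pi * Complex.I * (t : ℂ)))‖ = 1 := by
  have : -(2 * Real.pi * Complex.I * (t : ℂ)) = ((-(2 * Real.pi * t) : ℝ) : ℂ) * Complex.I := by
    push_cast; ring
  rw [this, Complex.norm_exp_ofReal_mul_I]

theorem exp_mul_conj_exp (s t : ℝ) :
    Complex.exp (-(2 * Real.pi * Complex.I * (s : ℂ))) *
      conj (Complex.exp (-(2 * Real.pi * Complex.I * (t : ℂ)))) =
    Complex.exp (-(2 * Real.pi * Complex.I * ((s - t : ℝ) : ℂ))) := by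
  rw [← Complex.exp_conj, ← Complex.exp_add]
  congr 1
  simp only [map_neg, map_mul, Complex.conj_ofReal, Complex.conj_I, Complex.conj_ofNat]
  push_cast
  ring

theorem fourier_eq_integral_exp {n : ℕ} (w : Space n → ℝ) (ξ : Space n) :
    𝓕 (fun x : Space n => (w x : ℂ)) ξ =
      ∫ x, Complex.exp (-(2 * Real.pi * Complex.I * ((⟪x, ξ⟫ : ℝ) : ℂ))) * w x := by
  rw [Real.fourier_eq']
  refine integral_congr_ae (Filter.Eventually.of_forall fun x => ?_)
  simp only [smul_eq_mul]
  congr 2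
  push_cast
  ring

theorem continuous_fourier_ofReal {n : ℕ} {w : Space n → ℝ} (hw : Integrable w) :
    Continuous (𝓕 (fun x : Space n => (w x : ℂ))) :=
  VectorFourier.fourierIntegral_continuous Real.continuous_fourierChar
    (by simpa using continuous_inner) hw.ofReal

/-- Expanding the square of the extension operator. -/
theorem lintegral_extension_sq_le {n : ℕ} {g : USphere n → ℂ}
    (hg : Integrable g (surfaceMeasure n)) {w : Space n → ℝ} (hw0 : ∀ x, 0 ≤ w x)
    (hw : Integrable w) :
    ∫⁻ x, ‖extension g x‖ₑ ^ 2 * ENNReal.ofReal (w x) ≤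
      ∫⁻ a, ∫⁻ b, ‖g a‖ₑ * ‖g b‖ₑ * ‖𝓕 (fun x : Space n => (w x : ℂ)) ((a : Space n) - b)‖ₑ
        ∂(surfaceMeasure n) ∂(surfaceMeasure n) := by
  set σ := surfaceMeasure n
  let e : Space n → Space n → ℂ := fun x a =>
    Complex.exp (-(2 * Real.pi * Complex.I * ((⟪x, a⟫ : ℝ) : ℂ)))
  let F : Space n × (USphere n × USphere n) → ℂ := fun p =>
    e p.1 ((p.2.1 : Space n) - p.2.2) * ((w p.1 : ℂ) * (g p.2.1 * conj (g p.2.2)))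
  have hgg : Integrable (fun z : USphere n × USphere n => g z.1 * conj (g z.2)) (σ.prod σ) :=
    hg.mul_prod (Complex.conjCLE.toContinuousLinearMap.integrable_comp hg)
  -- The exponential is unimodular, so Fubini needs only the integrability of w and g.
  have hF : Integrable F (volume.prod (σ.prod σ)) := by
    have h : Integrable (fun p : Space n × (USphere n × USphere n) =>
        (w p.1 : ℂ) * (g p.2.1 * conj (g p.2.2))) (volume.prod (σ.prod σ)) :=
      Integrable.mul_prod (f := fun x => (w x : ℂ)) hw.ofReal hgg
    refine h.bdd_mul (c := 1) ?_ ?_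
    · have : Continuous fun p : Space n × (USphere n × USphere n) =>
        e p.1 ((p.2.1 : Space n) - p.2.2) := by
        simp only [e]; fun_prop
      exact this.aestronglyMeasurable
    · exact Filter.Eventually.of_forall fun p => (norm_exp_neg_two_pi_I_mul _).le
  have hsq : ∀ x, ∫ z, F (x, z) ∂(σ.prod σ) = ((‖extension g x‖ ^ 2 * w x : ℝ) : ℂ) := by
    intro x
    have h1 : ∀ z : USphere n × USphere n, F (x, z) =
        (w x : ℂ) * ((e x z.1 * g z.1) * conj (e x z.2 * g z.2)) := by
      intro z
      have : e x z.1 * conj (e x z.2) = e x ((z.1 : Space n) - z.2) := by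
        simp only [e, exp_mul_conj_exp, inner_sub_right]
      simp only [F, map_mul, ← this]
      ring
    simp_rw [h1]
    rw [integral_const_mul, integral_prod_mul (fun a : USphere n => e x a * g a)
      (fun b : USphere n => conj (e x b * g b)), integral_conj]
    change (w x : ℂ) * (extension g x * conj (extension g x)) = _
    rw [Complex.mul_conj, Complex.normSq_eq_norm_sq]
    push_cast
    ring
  have hint : Integrable fun x => ‖extension g x‖ ^ 2 * w x := by
    have h := hF.integral_prod_left
    simp_rw [hsq] at h
    exact_mod_cast h.re
  have h1 : ∫⁻ x, ‖extension g x‖ₑ ^ 2 * ENNReal.ofReal (w x) =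
      ENNReal.ofReal (∫ x, ‖extension g x‖ ^ 2 * w x) := by
    rw [ofReal_integral_eq_lintegral_ofReal hint
      (Filter.Eventually.of_forall fun x => mul_nonneg (sq_nonneg _) (hw0 x))]
    refine lintegral_congr fun x => ?_
    rw [ENNReal.ofReal_mul (sq_nonneg _), ENNReal.ofReal_pow (norm_nonneg _), ofReal_norm]
  have h2 : ENNReal.ofReal (∫ x, ‖extension g x‖ ^ 2 * w x) =
      ‖∫ z, ∫ x, F (x, z) ∂volume ∂(σ.prod σ)‖ₑ := by
    have h3 : 0 ≤ ∫ x, ‖extension g x‖ ^ 2 * w x :=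
      integral_nonneg fun x => mul_nonneg (sq_nonneg _) (hw0 x)
    rw [← integral_integral_swap hF]
    simp_rw [hsq]
    rw [integral_complex_ofReal, ← ofReal_norm, Complex.norm_of_nonneg h3]
  have h4 : ∀ z : USphere n × USphere n, ∫ x, F (x, z) =
      g z.1 * conj (g z.2) * 𝓕 (fun x : Space n => (w x : ℂ)) ((z.1 : Space n) - z.2) := by
    intro z
    rw [fourier_eq_integral_exp, ← integral_const_mul]
    refine integral_congr_ae (Filter.Eventually.of_forall fun x => ?_)
    simp only [F, e]
    ring
  rw [h1, h2]
  refine (enorm_integral_le_lintegral_enorm _).trans (le_of_eq ?_)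
  simp_rw [h4]
  have hcw := continuous_fourier_ofReal hw
  rw [lintegral_prod]
  · simp [enorm_mul]
  · refine (hgg.aestronglyMeasurable.mul ?_).enorm
    exact (hcw.comp (by fun_prop : Continuous fun z : USphere n × USphere n =>
      (z.1 : Space n) - z.2)).aestronglyMeasurable


/-! ### Cauchy–Schwarz on the fibre over ω -/

/-- The pushforward under the chord map is dominated by Lebesgue measure on ⟨ω⟩^⊥, for which {0} is
null since that space has dimension n - 1 ≥ 1. -/
theorem ae_chord_ne_zero {n : ℕ} (hn : 2 ≤ n) {c : ℝ} (hc : 0 < c) (ω : USphere n) :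
    ∀ᵐ a ∂((surfaceMeasure n).restrict {a | c ≤ |⟪(ω : Space n), (a : Space n)⟫|}),
      chord ω a ≠ 0 := by
  have := nontrivial_perp hn ω
  have h := map_chord_le hc ω {0}
  rw [Measure.map_apply (continuous_chord ω).measurable (measurableSet_singleton _),
    Measure.smul_apply, measure_singleton, smul_zero] at h
  rw [ae_iff]
  simp only [not_not]
  exact le_antisymm h zero_le

theorem lintegral_chord_le {n : ℕ} {c : ℝ} (hc : 0 < c) (ω : USphere n) {F : perp ω → ℝ≥0∞}
    (hF : Measurable F) :
    ∫⁻ a in {a | c ≤ |⟪(ω : Space n), (a : Space n)⟫|}, F (chord ω a) ∂(surfaceMeasure n) ≤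
      (2 * n * Real.toNNReal (c⁻¹ + 2) ^ n : ℝ≥0) * ∫⁻ ξ, F ξ := by
  rw [← lintegral_map hF (continuous_chord ω).measurable]
  refine (lintegral_mono' (map_chord_le hc ω) le_rfl).trans (le_of_eq ?_)
  rw [lintegral_smul_measure, ENNReal.smul_def, smul_eq_mul]

/-- The Cauchy–Schwarz inequality on the fibre over `ω`, for a density whose reflected pairs keep
away from the equator. -/
theorem lintegral_fibre_le {n : ℕ} (hn : 2 ≤ n) {c : ℝ} (hc : 0 < c) (s : ℝ) {g : USphere n → ℂ}
    (hg : Measurable g)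
    (ω : USphere n) (hcap : ∀ a, g a ≠ 0 → g (geodesicReflection ω a) ≠ 0 →
      c ≤ |⟪(ω : Space n), (a : Space n)⟫|)
    {w : Space n → ℝ} (hw : Integrable w) :
    ∫⁻ a, ‖g a‖ₑ * ‖g (geodesicReflection ω a)‖ₑ *
        ‖𝓕 (fun x : Space n => (w x : ℂ)) ((a : Space n) - geodesicReflection ω a)‖ₑ
        ∂(surfaceMeasure n) ≤
      ((Real.toNNReal c)⁻¹ ^ (n - 2) : ℝ≥0) ^ (1 / 2 : ℝ) *
      (2 * n * Real.toNNReal (c⁻¹ + 2) ^ n : ℝ≥0) ^ (1 / 2 : ℝ) *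
      (fractionalIntegral (2 * s) (fun a => ‖g a‖ₑ ^ 2) (fun a => ‖g a‖ₑ ^ 2) ω ^ (1 / 2 : ℝ) *
        homSobolevNorm s (xray w ω)) := by
  set σ := surfaceMeasure n
  set A : Set (USphere n) := {a | c ≤ |⟪(ω : Space n), (a : Space n)⟫|}
  have hA : MeasurableSet A := (isClosed_le (by fun_prop) (by fun_prop)).measurableSet
  have hR : Measurable (geodesicReflection ω) :=
    (lipschitzWith_geodesicReflection_right ω).continuous.measurable
  have hch := (continuous_chord ω).measurable
  have hgR : Measurable fun a => g (geodesicReflection ω a) := hg.comp hR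
  set W : perp ω → ℝ≥0∞ := fun ξ => ‖𝓕 (fun v : perp ω => (xray w ω v : ℂ)) ξ‖ₑ
  have hWeq : ∀ ξ : perp ω, W ξ = ‖𝓕 (fun x : Space n => (w x : ℂ)) (ξ : Space n)‖ₑ := fun ξ => by
    simp only [W, fourier_xray hw]
  have hW : Measurable W := by
    have : W = fun ξ : perp ω => ‖𝓕 (fun x : Space n => (w x : ℂ)) (ξ : Space n)‖ₑ := funext hWeq
    rw [this]
    exact ((continuous_fourier_ofReal hw).comp continuous_subtype_val).measurable.enorm
  set y : USphere n → ℝ≥0∞ := fun a => ‖chord ω a‖ₑ ^ (2 * s)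
  have hy : Measurable y := hch.enorm.pow_const _
  -- The Cauchy–Schwarz factors: f carries |chord|^(-s), h carries |chord|^s.
  set f : USphere n → ℝ≥0∞ := fun a =>
    ‖g a‖ₑ * ‖g (geodesicReflection ω a)‖ₑ * (y a)⁻¹ ^ (1 / 2 : ℝ)
  set h : USphere n → ℝ≥0∞ := fun a => W (chord ω a) * y a ^ (1 / 2 : ℝ)
  have hf : Measurable f := (hg.enorm.mul hgR.enorm).mul (hy.inv.pow_const _)
  have hh : Measurable h := (hW.comp hch).mul (hy.pow_const _)
  have hsq : ∀ x : ℝ≥0∞, (x ^ (1 / 2 : ℝ)) ^ (2 : ℝ) = x := fun x => by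
    rw [← ENNReal.rpow_mul]; norm_num
  have step1 : ∫⁻ a, ‖g a‖ₑ * ‖g (geodesicReflection ω a)‖ₑ *
        ‖𝓕 (fun x : Space n => (w x : ℂ)) ((a : Space n) - geodesicReflection ω a)‖ₑ ∂σ ≤
      ∫⁻ a in A, (f * h) a ∂σ := by
    have hsupp : ∀ a, ‖g a‖ₑ * ‖g (geodesicReflection ω a)‖ₑ *
        ‖𝓕 (fun x : Space n => (w x : ℂ)) ((a : Space n) - geodesicReflection ω a)‖ₑ =
        A.indicator (fun a => ‖g a‖ₑ * ‖g (geodesicReflection ω a)‖ₑ * W (chord ω a)) a := by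
      intro a
      by_cases ha : a ∈ A
      · rw [Set.indicator_of_mem ha, hWeq, coe_chord]
      · rw [Set.indicator_of_notMem ha]
        have : g a = 0 ∨ g (geodesicReflection ω a) = 0 := by
          by_contra! hne
          exact ha (hcap a hne.1 hne.2)
        rcases this with h0 | h0 <;> simp [h0]
    simp_rw [hsupp]
    rw [lintegral_indicator hA]
    refine lintegral_mono_ae ?_
    filter_upwards [ae_chord_ne_zero hn hc ω] with a ha
    -- Off the zero chord, `y a` is neither 0 nor ∞ whatever the sign of s, so the inserted powers
    -- cancel.
    have hx0 : ‖chord ω a‖ₑ ≠ 0 := by simpa using ha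
    have hy0 : y a ≠ 0 := by simp [y, ENNReal.rpow_eq_zero_iff, hx0]
    have hyt : y a ≠ ⊤ := by simp [y, ENNReal.rpow_eq_top_iff, hx0]
    have h1 : (y a)⁻¹ ^ (1 / 2 : ℝ) * y a ^ (1 / 2 : ℝ) = 1 := by
      rw [← ENNReal.mul_rpow_of_nonneg _ _ (by norm_num), ENNReal.inv_mul_cancel hy0 hyt,
        ENNReal.one_rpow]
    refine le_of_eq ?_
    calc _ = ‖g a‖ₑ * ‖g (geodesicReflection ω a)‖ₑ * W (chord ω a) *
          ((y a)⁻¹ ^ (1 / 2 : ℝ) * y a ^ (1 / 2 : ℝ)) := by rw [h1, mul_one]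
      _ = _ := by simp only [f, h, Pi.mul_apply]; ring
  have step2 : ∫⁻ a in A, f a ^ (2 : ℝ) ∂σ ≤ ((Real.toNNReal c)⁻¹ ^ (n - 2) : ℝ≥0) *
      fractionalIntegral (2 * s) (fun a => ‖g a‖ₑ ^ 2) (fun a => ‖g a‖ₑ ^ 2) ω := by
    rw [fractionalIntegral, ← lintegral_const_mul' _ _ ENNReal.coe_ne_top]
    refine (setLIntegral_mono' hA fun a ha => ?_).trans (setLIntegral_le_lintegral A _)
    have hc' : (Real.toNNReal c : ℝ≥0∞) ≤ ‖(⟪(ω : Space n), (a : Space n)⟫ : ℝ)‖ₑ := by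
      rw [← ofReal_norm, Real.norm_eq_abs]
      exact ENNReal.ofReal_le_ofReal ha
    -- On A the weight |ω · a|^(n - 2) is inserted at the cost of c^(-(n - 2)).
    have h1 : (1 : ℝ≥0∞) ≤ ((Real.toNNReal c)⁻¹ ^ (n - 2) : ℝ≥0) *
        ‖(⟪(ω : Space n), (a : Space n)⟫ : ℝ)‖ₑ ^ (n - 2) := by
      have hne : Real.toNNReal c ≠ 0 := by simpa using hc
      rw [ENNReal.coe_pow, ← mul_pow, ENNReal.coe_inv hne]
      refine one_le_pow₀ ?_
      rw [← ENNReal.inv_mul_cancel (a := (Real.toNNReal c : ℝ≥0∞)) (by simpa using hc)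
        ENNReal.coe_ne_top]
      gcongr
    have h2 : f a ^ (2 : ℝ) = ‖g a‖ₑ ^ 2 * ‖g (geodesicReflection ω a)‖ₑ ^ 2 /
        ‖(a : Space n) - geodesicReflection ω a‖ₑ ^ (2 * s) := by
      simp only [f]
      rw [ENNReal.mul_rpow_of_nonneg _ _ (by norm_num), hsq, ENNReal.rpow_two, mul_pow,
        ENNReal.div_eq_inv_mul, mul_comm]
      rfl
    rw [h2]
    calc _ = 1 * (‖g a‖ₑ ^ 2 * ‖g (geodesicReflection ω a)‖ₑ ^ 2 /
          ‖(a : Space n) - geodesicReflection ω a‖ₑ ^ (2 * s)) := (one_mul _).symm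
      _ ≤ _ := mul_le_mul_left h1 _
      _ = _ := by ring
  have step3 : ∫⁻ a in A, h a ^ (2 : ℝ) ∂σ ≤ (2 * n * Real.toNNReal (c⁻¹ + 2) ^ n : ℝ≥0) *
      ∫⁻ ξ : perp ω, ‖ξ‖ₑ ^ (2 * s) * W ξ ^ 2 := by
    have hF : Measurable fun ξ : perp ω => ‖ξ‖ₑ ^ (2 * s) * W ξ ^ 2 :=
      (measurable_enorm.pow_const _).mul (hW.pow_const _)
    refine le_trans (le_of_eq ?_) (lintegral_chord_le hc ω hF)
    refine lintegral_congr fun a => ?_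
    simp only [h]
    rw [ENNReal.mul_rpow_of_nonneg _ _ (by norm_num), hsq, ENNReal.rpow_two, mul_comm]
  refine step1.trans ((ENNReal.lintegral_mul_le_Lp_mul_Lq _ Real.HolderConjugate.two_two
    hf.aemeasurable hh.aemeasurable).trans ?_)
  have hhalf : (0 : ℝ) ≤ 1 / 2 := by norm_num
  refine (mul_le_mul' (ENNReal.rpow_le_rpow step2 hhalf)
    (ENNReal.rpow_le_rpow step3 hhalf)).trans (le_of_eq ?_)
  rw [ENNReal.mul_rpow_of_nonneg _ _ hhalf, ENNReal.mul_rpow_of_nonneg _ _ hhalf, homSobolevNorm]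
  ring

/-! ### Integration over ω -/

/-- A one-sided substitute for the change of variables b = R_ω a, with constant (1 + 2K)^n for K =
4. -/
theorem lintegral_le_lintegral_geodesicReflection {n : ℕ} (hn : 2 ≤ n) (a : USphere n)
    {F : USphere n → ℝ≥0∞} (hF : Measurable F) :
    ∫⁻ b, F b ∂(surfaceMeasure n) ≤
      ((1 + 2 * 4) ^ n : ℝ≥0) * ∫⁻ ω, F (geodesicReflection ω a) ∂(surfaceMeasure n) := by
  have hl := lipschitzWith_geodesicReflection_left a
  rw [← lintegral_map hF hl.continuous.measurable]
  refine (lintegral_mono' (surfaceMeasure_le_map hl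
    (surjective_geodesicReflection_left hn a)) le_rfl).trans (le_of_eq ?_)
  rw [lintegral_smul_measure, ENNReal.smul_def, smul_eq_mul]

/-- The constant in the inequality for densities whose reflected pairs keep away from the
equator. -/
def capConstant (n : ℕ) (c : ℝ) : ℝ≥0∞ :=
  ((1 + 2 * 4) ^ n : ℝ≥0) * (((Real.toNNReal c)⁻¹ ^ (n - 2) : ℝ≥0) ^ (1 / 2 : ℝ) *
    (2 * n * Real.toNNReal (c⁻¹ + 2) ^ n : ℝ≥0) ^ (1 / 2 : ℝ))

theorem capConstant_ne_top (n : ℕ) (c : ℝ) : capConstant n c ≠ ⊤ :=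
  ENNReal.mul_ne_top ENNReal.coe_ne_top (ENNReal.mul_ne_top
    (ENNReal.rpow_ne_top_of_nonneg (by norm_num) ENNReal.coe_ne_top)
    (ENNReal.rpow_ne_top_of_nonneg (by norm_num) ENNReal.coe_ne_top))

/-- The inequality for densities whose reflected pairs keep away from the equator. -/
theorem lintegral_extension_sq_le_of_cap {n : ℕ} (hn : 2 ≤ n) {c : ℝ} (hc : 0 < c) (s : ℝ)
    {g : USphere n → ℂ} (hg : Measurable g) (hgi : Integrable g (surfaceMeasure n))
    (hcap : ∀ ω a, g a ≠ 0 → g (geodesicReflection ω a) ≠ 0 →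
      c ≤ |⟪(ω : Space n), (a : Space n)⟫|)
    {w : Space n → ℝ} (hw0 : ∀ x, 0 ≤ w x) (hw : Integrable w) :
    ∫⁻ x, ‖extension g x‖ₑ ^ 2 * ENNReal.ofReal (w x) ≤
      capConstant n c *
      ∫⁻ ω, fractionalIntegral (2 * s) (fun a => ‖g a‖ₑ ^ 2) (fun a => ‖g a‖ₑ ^ 2) ω
          ^ (1 / 2 : ℝ) * homSobolevNorm s (xray w ω) ∂(surfaceMeasure n) := by
  have hcw := (continuous_fourier_ofReal hw).measurable
  set σ := surfaceMeasure n
  set G : USphere n → USphere n → ℝ≥0∞ := fun a b =>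
    ‖g a‖ₑ * ‖g b‖ₑ * ‖𝓕 (fun x : Space n => (w x : ℂ)) ((a : Space n) - b)‖ₑ
  have hG : Measurable (Function.uncurry G) := by
    refine ((hg.comp measurable_fst).enorm.mul (hg.comp measurable_snd).enorm).mul
      (hcw.comp ?_).enorm
    exact (by fun_prop : Continuous fun p : USphere n × USphere n =>
      (p.1 : Space n) - p.2).measurable
  have hGR : Measurable (Function.uncurry fun a ω => G a (geodesicReflection ω a)) :=
    hG.comp (measurable_fst.prodMk
      (continuous_geodesicReflection.measurable.comp measurable_swap))
  calc ∫⁻ x, ‖extension g x‖ₑ ^ 2 * ENNReal.ofReal (w x)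
      ≤ ∫⁻ a, ∫⁻ b, G a b ∂σ ∂σ := lintegral_extension_sq_le hgi hw0 hw
    _ ≤ ∫⁻ a, ((1 + 2 * 4) ^ n : ℝ≥0) * ∫⁻ ω, G a (geodesicReflection ω a) ∂σ ∂σ :=
        lintegral_mono fun a => lintegral_le_lintegral_geodesicReflection hn a
          (hG.comp measurable_prodMk_left)
    _ = ((1 + 2 * 4) ^ n : ℝ≥0) * ∫⁻ ω, ∫⁻ a, G a (geodesicReflection ω a) ∂σ ∂σ := by
        rw [lintegral_const_mul' _ _ ENNReal.coe_ne_top, lintegral_lintegral_swap hGR.aemeasurable]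
    _ ≤ _ := by
        rw [capConstant, mul_assoc]
        gcongr
        -- Finiteness of the constant lets it move through the integral without measurability in ω
        -- of the integrand.
        rw [← lintegral_const_mul' _ _ (ENNReal.mul_ne_top
          (ENNReal.rpow_ne_top_of_nonneg (by norm_num) ENNReal.coe_ne_top)
          (ENNReal.rpow_ne_top_of_nonneg (by norm_num) ENNReal.coe_ne_top))]
        exact lintegral_mono fun ω => lintegral_fibre_le hn hc s hg ω (hcap ω) hw

/-! ### Dependence on the density -/

theorem extension_congr {n : ℕ} {g g' : USphere n → ℂ} (h : g =ᵐ[surfaceMeasure n] g') :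
    extension g = extension g' := by
  funext x
  refine integral_congr_ae ?_
  filter_upwards [h] with a ha
  rw [ha]

/-- As R_ω is its own inverse, the domination of σ by its pushforward, applied to the preimage of a
null set, shows that this preimage is null. -/
theorem quasiMeasurePreserving_geodesicReflection {n : ℕ} (ω : USphere n) :
    QuasiMeasurePreserving (geodesicReflection ω) (surfaceMeasure n) (surfaceMeasure n) := by
  have hl := lipschitzWith_geodesicReflection_right ω
  have hm := hl.continuous.measurable
  refine ⟨hm, Measure.AbsolutelyContinuous.mk fun s hs h0 => ?_⟩
  have h := surfaceMeasure_le_map hl (geodesicReflection_involutive ω).surjective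
    (geodesicReflection ω ⁻¹' s)
  rw [Measure.smul_apply, Measure.map_apply hm (hm hs), ← Set.preimage_comp,
    (geodesicReflection_involutive ω).comp_self, Set.preimage_id, h0, smul_zero] at h
  rw [Measure.map_apply hm hs]
  exact le_antisymm h zero_le

theorem fractionalIntegral_congr {n : ℕ} (s : ℝ) {g g' : USphere n → ℝ≥0∞}
    (h : g =ᵐ[surfaceMeasure n] g') :
    fractionalIntegral s g g = fractionalIntegral s g' g' := by
  funext ω
  refine lintegral_congr_ae ?_
  filter_upwards [h, (quasiMeasurePreserving_geodesicReflection ω).ae h] with a h1 h2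
  rw [h1, h2]

theorem fractionalIntegral_mono {n : ℕ} (s : ℝ) {g g' : USphere n → ℝ≥0∞} (h : g ≤ g')
    (ω : USphere n) : fractionalIntegral s g g ω ≤ fractionalIntegral s g' g' ω := by
  refine lintegral_mono fun a => ?_
  have h1 := h a
  have h2 := h (geodesicReflection ω a)
  dsimp only
  gcongr

theorem continuous_extension {n : ℕ} {g : USphere n → ℂ} (hg : Integrable g (surfaceMeasure n)) :
    Continuous (extension g) := by
  refine continuous_of_dominated (bound := fun a => ‖g a‖) (fun x => ?_) (fun x => ?_) hg.norm ?_
  · refine AEStronglyMeasurable.mul (Continuous.aestronglyMeasurable ?_) hg.1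
    fun_prop
  · exact Filter.Eventually.of_forall fun a => by
      rw [norm_mul, norm_exp_neg_two_pi_I_mul, one_mul]
  · exact Filter.Eventually.of_forall fun a => by fun_prop

/-! ### Splitting into orthants -/

/-- The sign pattern of a point of the sphere. -/
def orthant {n : ℕ} (a : USphere n) : Fin n → Bool := fun i => decide (0 ≤ (a : Space n) i)

theorem measurableSet_orthant_eq {n : ℕ} (κ : Fin n → Bool) :
    MeasurableSet {a : USphere n | orthant a = κ} := by
  have : {a : USphere n | orthant a = κ} =
      ⋂ i, {a : USphere n | decide (0 ≤ (a : Space n) i) = κ i} := by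
    ext a; simp [orthant, funext_iff]
  rw [this]
  refine MeasurableSet.iInter fun i => ?_
  have hcl : MeasurableSet {a : USphere n | 0 ≤ (a : Space n) i} :=
    (isClosed_le (by fun_prop) (by fun_prop)).measurableSet
  cases κ i
  · simpa [Set.compl_ofPred] using hcl.compl
  · simpa using hcl

/-- Equal sign patterns give 0 ≤ a · R_ω a = 2 (ω · a)² - 1, so |ω · a| ≥ 1/√2; the bound 1/2 is a
convenient weakening. -/
theorem half_le_abs_inner_of_orthant_eq {n : ℕ} (ω a : USphere n)
    (h : orthant a = orthant (geodesicReflection ω a)) :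
    1 / 2 ≤ |⟪(ω : Space n), (a : Space n)⟫| := by
  have h1 : 0 ≤ ⟪(a : Space n), (geodesicReflection ω a : Space n)⟫ := by
    rw [PiLp.inner_apply]
    refine Finset.sum_nonneg fun i _ => ?_
    have hi := congrFun h i
    simp only [orthant, decide_eq_decide] at hi
    by_cases h0 : 0 ≤ (a : Space n) i
    · exact mul_nonneg (hi.1 h0) h0
    · exact mul_nonneg_of_nonpos_of_nonpos (not_le.1 fun h' => h0 (hi.2 h')).le (not_le.1 h0).le
  rw [coe_geodesicReflection, inner_sub_right, real_inner_smul_right, inner_self_usphere,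
    real_inner_comm (ω : Space n) (a : Space n)] at h1
  refine abs_le_of_sq_le_sq' ?_ (abs_nonneg _) |>.2
  rw [sq_abs]
  nlinarith

theorem extension_finset_sum {n : ℕ} {ι : Type*} (t : Finset ι) {f : ι → USphere n → ℂ}
    (hf : ∀ i ∈ t, Integrable (f i) (surfaceMeasure n)) (x : Space n) :
    extension (fun a => ∑ i ∈ t, f i a) x = ∑ i ∈ t, extension (f i) x := by
  unfold extension
  rw [← integral_finsetSum]
  · simp_rw [Finset.mul_sum]
  · intro i hi
    refine (hf i hi).bdd_mul (c := 1) (Continuous.aestronglyMeasurable (by fun_prop))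
      (Filter.Eventually.of_forall fun a => (norm_exp_neg_two_pi_I_mul _).le)

/-- The inequality for Borel densities, by splitting the density into orthants. -/
theorem lintegral_extension_sq_le_of_measurable {n : ℕ} (hn : 2 ≤ n) (s : ℝ)
    {g : USphere n → ℂ} (hg : Measurable g) (hgi : Integrable g (surfaceMeasure n))
    {w : Space n → ℝ} (hw0 : ∀ x, 0 ≤ w x) (hw : Integrable w) :
    ∫⁻ x, ‖extension g x‖ₑ ^ 2 * ENNReal.ofReal (w x) ≤
      2 ^ n * 2 ^ n * capConstant n (1 / 2) *
      ∫⁻ ω, fractionalIntegral (2 * s) (fun a => ‖g a‖ₑ ^ 2) (fun a => ‖g a‖ₑ ^ 2) ω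
          ^ (1 / 2 : ℝ) * homSobolevNorm s (xray w ω) ∂(surfaceMeasure n) := by
  set P : (Fin n → Bool) → Set (USphere n) := fun κ => {a | orthant a = κ}
  have hP : ∀ κ, MeasurableSet (P κ) := measurableSet_orthant_eq
  set p : (Fin n → Bool) → USphere n → ℂ := fun κ => (P κ).indicator g
  have hpi : ∀ κ, Integrable (p κ) (surfaceMeasure n) := fun κ => hgi.indicator (hP κ)
  have hsum : g = fun a => ∑ κ, p κ a := by
    funext a
    rw [Finset.sum_eq_single (orthant a)]
    · exact (Set.indicator_of_mem (show a ∈ P (orthant a) from rfl) g).symm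
    · intro κ _ hκ
      exact Set.indicator_of_notMem (s := P κ) (fun h : orthant a = κ => hκ h.symm) g
    · simp
  -- Cauchy–Schwarz over the 2^n pieces removes the cross terms between different orthants.
  have hsq : ∀ x, ‖extension g x‖ₑ ^ 2 ≤ 2 ^ n * ∑ κ, ‖extension (p κ) x‖ₑ ^ 2 := by
    intro x
    have h1 : ‖extension g x‖₊ ≤ ∑ κ, ‖extension (p κ) x‖₊ := by
      conv_lhs => rw [hsum, extension_finset_sum _ fun κ _ => hpi κ]
      exact nnnorm_sum_le _ _
    have h2 : ‖extension g x‖₊ ^ 2 ≤ 2 ^ n * ∑ κ, ‖extension (p κ) x‖₊ ^ 2 := by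
      refine (pow_le_pow_left' h1 2).trans (sq_sum_le_card_mul_sum_sq.trans (le_of_eq ?_))
      simp
    simp only [enorm_eq_nnnorm]
    exact_mod_cast h2
  have hcap : ∀ κ ω a, p κ a ≠ 0 → p κ (geodesicReflection ω a) ≠ 0 →
      1 / 2 ≤ |⟪(ω : Space n), (a : Space n)⟫| := by
    intro κ ω a h1 h2
    have h1' : orthant a = κ := Set.mem_of_indicator_ne_zero (s := P κ) h1
    have h2' : orthant (geodesicReflection ω a) = κ := Set.mem_of_indicator_ne_zero (s := P κ) h2
    exact half_le_abs_inner_of_orthant_eq ω a (h1'.trans h2'.symm)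
  have hm : ∀ κ, AEMeasurable fun x => ‖extension (p κ) x‖ₑ ^ 2 * ENNReal.ofReal (w x) :=
    fun κ => ((continuous_extension (hpi κ)).measurable.enorm.pow_const 2).aemeasurable.mul
      hw.1.aemeasurable.ennreal_ofReal
  set X := ∫⁻ ω, fractionalIntegral (2 * s) (fun a => ‖g a‖ₑ ^ 2) (fun a => ‖g a‖ₑ ^ 2) ω
          ^ (1 / 2 : ℝ) * homSobolevNorm s (xray w ω) ∂(surfaceMeasure n)
  have hpiece : ∀ κ, ∫⁻ x, ‖extension (p κ) x‖ₑ ^ 2 * ENNReal.ofReal (w x) ≤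
      capConstant n (1 / 2) * X := by
    intro κ
    refine (lintegral_extension_sq_le_of_cap hn (by norm_num) s (hg.indicator (hP κ)) (hpi κ)
      (hcap κ) hw0 hw).trans ?_
    refine mul_le_mul_right (lintegral_mono fun ω => mul_le_mul_left ?_ _) _
    refine ENNReal.rpow_le_rpow (fractionalIntegral_mono _ (fun a => ?_) ω) (by norm_num)
    exact pow_le_pow_left' (enorm_indicator_le_enorm_self g a) 2
  calc ∫⁻ x, ‖extension g x‖ₑ ^ 2 * ENNReal.ofReal (w x)
      ≤ ∫⁻ x, 2 ^ n * ∑ κ, ‖extension (p κ) x‖ₑ ^ 2 * ENNReal.ofReal (w x) := by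
        refine lintegral_mono fun x => ?_
        rw [← Finset.sum_mul, ← mul_assoc]
        exact mul_le_mul_left (hsq x) _
    _ = 2 ^ n * ∑ κ, ∫⁻ x, ‖extension (p κ) x‖ₑ ^ 2 * ENNReal.ofReal (w x) := by
        rw [lintegral_const_mul' _ _ (by simp), lintegral_finsetSum' _ fun κ _ => hm κ]
    -- The second factor 2^n counts the pieces, each bounded by the same quantity for the full g.
    _ ≤ 2 ^ n * ∑ _κ : Fin n → Bool, capConstant n (1 / 2) * X := by
        gcongr with κ
        exact hpiece κ
    _ = _ := by
        simp only [Finset.sum_const, Finset.card_univ, Fintype.card_pi, Fintype.card_bool,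
          Finset.prod_const, Fintype.card_fin, nsmul_eq_mul]
        push_cast
        ring

end SphericalSobolevStein

end

/-! ### The inequality for integrable densities -/

theorem theorem3p3 (n : ℕ) (hn : 2 ≤ n) :
    ∃ c : ℝ≥0, ∀ s : ℝ, s < ((n : ℝ) - 1) / 2 →
      ∀ g : SphericalSobolevStein.USphere n → ℂ,
        Integrable g (SphericalSobolevStein.surfaceMeasure n) →
      ∀ w : SphericalSobolevStein.Space n → ℝ, (∀ x, 0 ≤ w x) → Integrable w →
        ∫⁻ x, ‖SphericalSobolevStein.extension g x‖ₑ ^ 2 * ENNReal.ofReal (w x) ≤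
          (c : ℝ≥0∞) * ∫⁻ ω,
            (SphericalSobolevStein.fractionalIntegral (2 * s)
                (fun ω' => ‖g ω'‖ₑ ^ 2) (fun ω' => ‖g ω'‖ₑ ^ 2) ω) ^ (1 / 2 : ℝ)
              * SphericalSobolevStein.homSobolevNorm s (SphericalSobolevStein.xray w ω)
            ∂(SphericalSobolevStein.surfaceMeasure n) := by
  have hC : 2 ^ n * 2 ^ n * SphericalSobolevStein.capConstant n (1 / 2) ≠ ⊤ :=
    ENNReal.mul_ne_top (by finiteness) (SphericalSobolevStein.capConstant_ne_top n _)
  refine ⟨(2 ^ n * 2 ^ n * SphericalSobolevStein.capConstant n (1 / 2)).toNNReal, fun s _ g hg w hw0 hw => ?_⟩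
  rw [ENNReal.coe_toNNReal hC]
  -- An integrable g is only almost everywhere equal to a Borel function; both sides are unchanged
  -- on passing to that representative.
  have hgm := hg.1.ae_eq_mk
  have hsq : (fun a => ‖g a‖ₑ ^ 2) =ᵐ[SphericalSobolevStein.surfaceMeasure n]
      fun a => ‖hg.1.mk g a‖ₑ ^ 2 := by
    filter_upwards [hgm] with a ha
    rw [← ha]
  rw [SphericalSobolevStein.extension_congr hgm,
    SphericalSobolevStein.fractionalIntegral_congr _ hsq]
  exact SphericalSobolevStein.lintegral_extension_sq_le_of_measurable hn s
    hg.1.stronglyMeasurable_mk.measurable (hg.congr hgm) hw0 hw
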